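/- Let $\mathcal H$ be a real Hilbert space. For a nonempty closed convex set $C\subseteq\mathcal H$, let $P_C$ denote the projector onto $C$ (sending $x$ to the unique point of $C$ nearest to $x$); for $C \subseteq \mathcal H$ let $d_C$ be its distance function and $C^{\ominus}=\{u\in\mathcal H : \sup_{c\in C}\langle c,u\rangle\le 0\}$ its polar cone. Put $q=\tfrac12\|\cdot\|^2$. Let $\Gamma_0(\mathcal H)$ be the set of convex, lower semicontinuous, proper functions $f\colon\mathcal H\to\,]-\infty,+\infty]$; the proximity operator of $f\in\Gamma_0(\mathcal H)$ sends $x$ to the unique minimizer of $y\mapsto f(y)+\tfrac12\|x-y\|^2$. Let $K_1$ and $K_2$ be nonempty closed convex cones in $\mathcal H$. Then the following are equivalent: (i) $K_1+K_2$ is closed and $P_{K_1}+P_{K_2}=P_{K_1+K_2}$. (ii) There exists a nonempty closed convex cone $K$ such that $P_{K_1}+P_{K_2}=P_K$. (iii) $P_{K_1}+P_{K_2}$ is the proximity operator of a function in $\Gamma_0(\mathcal H)$. (iv) $P_{K_1}+P_{K_2}$ is nonexpansive, i.e. Lipschitz continuous with constant $1$. (v) $\mathrm{Id}-P_{K_1}-P_{K_2}$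 is monotone, where $T\colon\mathcal H\to\mathcal H$ is monotone if $\langle x-y,Tx-Ty\rangle\ge 0$ for all $x,y\in\mathcal H$. (vi) $\langle P_{K_1}x,P_{K_2}x\rangle=0$ for all $x\in\mathcal H$. Furthermore, if one of (i)–(vi) holds, then $$d_{K_1+K_2}^2=d_{K_1}^2+d_{K_2}^2-2q=d_{K_1}^2-d_{K_2^{\ominus}}^2=d_{K_2}^2-d_{K_1^{\ominus}}^2 .$$ -/

import Mathlib

open scoped Pointwise

/-- A nonempty closed convex cone: a nonempty, closed, convex set that is stable under
multiplication by positive scalars. -/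
structure IsClosedConvexCone {H : Type*} [NormedAddCommGroup H] [InnerProductSpace ℝ H]
    (K : Set H) : Prop where
  nonempty : K.Nonempty
  isClosed : IsClosed K
  convex : Convex ℝ K
  smul_mem : ∀ c : ℝ, 0 < c → ∀ x ∈ K, c • x ∈ K

/-- `p` is a point of `C` nearest to `x`. -/
def IsNearestPoint {H : Type*} [NormedAddCommGroup H] (C : Set H) (x p : H) : Prop :=
  p ∈ C ∧ dist x p = Metric.infDist x C

/-- In a Hilbert space every point has a unique nearest point in a given nonempty closed
convex set. -/
theorem existsUnique_isNearestPoint {H : Type*} [NormedAddCommGroup H] [InnerProductSpace ℝ H]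
    [CompleteSpace H] {C : Set H} (hne : C.Nonempty) (hcl : IsClosed C) (hcv : Convex ℝ C)
    (x : H) : ∃! p, IsNearestPoint C x p := by
  have key : ∀ p, dist x p = Metric.infDist x C ↔ ‖x - p‖ = ⨅ w : C, ‖x - w‖ := by
    intro p
    rw [Metric.infDist_eq_iInf, dist_eq_norm]
    simp only [dist_eq_norm]
  obtain ⟨p, hp, hpx⟩ := exists_norm_eq_iInf_of_complete_convex hne hcl.isComplete hcv x
  refine ⟨p, ⟨hp, (key p).2 hpx⟩, ?_⟩
  rintro r ⟨hr, hrx⟩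
  have h1 := (norm_eq_iInf_iff_real_inner_le_zero hcv hp).1 hpx r hr
  have h2 := (norm_eq_iInf_iff_real_inner_le_zero hcv hr).1 ((key r).1 hrx) p hp
  have h3 : inner ℝ (r - p) (r - p) ≤ 0 := by
    have e : inner ℝ (r - p) (r - p) = inner ℝ (x - p) (r - p) + inner ℝ (x - r) (p - r) := by
      rw [← neg_sub r p, inner_neg_right, ← sub_eq_add_neg, ← inner_sub_left]
      congr 1
      abel
    linarith
  rw [real_inner_self_eq_norm_sq] at h3
  have h4 : ‖r - p‖ = 0 := by nlinarith [norm_nonneg (r - p)]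
  exact sub_eq_zero.1 (norm_eq_zero.1 h4)

/-- The projector `P_C`, sending `x` to its nearest point in `C`. It is meaningful whenever `C` is
nonempty, closed and convex. -/
noncomputable def projector {H : Type*} [NormedAddCommGroup H] (C : Set H) (x : H) : H :=
  Classical.epsilon (IsNearestPoint C x)

/-- For a nonempty closed convex set, `projector C x` is the one and only nearest point. -/
theorem projector_eq_iff {H : Type*} [NormedAddCommGroup H] [InnerProductSpace ℝ H]
    [CompleteSpace H] {C : Set H} (hne : C.Nonempty) (hcl : IsClosed C) (hcv : Convex ℝ C)
    (x p : H) : projector C x = p ↔ IsNearestPoint C x p := by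
  have h := existsUnique_isNearestPoint hne hcl hcv x
  have hs : IsNearestPoint C x (projector C x) := Classical.epsilon_spec h.exists
  exact ⟨fun e => e ▸ hs, fun hp => h.unique hs hp⟩

/-- The polar cone `{u | ⟪c, u⟫ ≤ 0 for all c ∈ C}`. -/
def polarCone {H : Type*} [NormedAddCommGroup H] [InnerProductSpace ℝ H] (C : Set H) : Set H :=
  {u | ∀ c ∈ C, inner ℝ c u ≤ 0}

/-- The function `q = ‖·‖² / 2`. -/
noncomputable def halfSq {H : Type*} [NormedAddCommGroup H] (x : H) : ℝ :=
  (1 / 2) * ‖x‖ ^ 2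

/-- The class `Γ₀(H)` of convex, lower semicontinuous, proper functions from `H` to
`]-∞, +∞]`; convexity is convexity of the epigraph. -/
structure IsGammaZero {H : Type*} [NormedAddCommGroup H] [InnerProductSpace ℝ H]
    (f : H → EReal) : Prop where
  ne_bot : ∀ x, f x ≠ ⊥
  exists_ne_top : ∃ x, f x ≠ ⊤
  lowerSemicontinuous : LowerSemicontinuous f
  convex_epigraph : Convex ℝ {p : H × ℝ | f p.1 ≤ (p.2 : EReal)}

/-- `T` is the proximity operator of `f`: for every `x`, the point `T x` is the unique minimizer
of `y ↦ f y + ‖x - y‖² / 2`. -/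
def IsProxOf {H : Type*} [NormedAddCommGroup H] (f : H → EReal) (T : H → H) : Prop :=
  ∀ x y, y ≠ T x →
    f (T x) + ((halfSq (x - T x) : ℝ) : EReal) < f y + ((halfSq (x - y) : ℝ) : EReal)

/-- `T` is a proximity operator, that is, the proximity operator of some function in `Γ₀(H)`. -/
def IsProximityOperator {H : Type*} [NormedAddCommGroup H] [InnerProductSpace ℝ H]
    (T : H → H) : Prop :=
  ∃ f : H → EReal, IsGammaZero f ∧ IsProxOf f T

/-- `T` is nonexpansive. -/
def IsNonexpansive {H : Type*} [NormedAddCommGroup H] (T : H → H) : Prop :=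
  ∀ x y, ‖T x - T y‖ ≤ ‖x - y‖

/-- `T` is a monotone operator. -/
def IsMonotoneOperator {H : Type*} [NormedAddCommGroup H] [InnerProductSpace ℝ H]
    (T : H → H) : Prop :=
  ∀ x y, 0 ≤ inner ℝ (x - y) (T x - T y)

/-! The implications run in a cycle; 5 → 6 and 6 → 1 carry the weight. Write P = P₁ + P₂. For 5 → 6,
monotonicity of Id - P tested at points of K₁ and 0 forces P₂ to vanish on K₁, so ⟪P₁x, P₂x⟫ ≤ 0;
tested at x and t P₁x with t → ∞ it gives the reverse sign. For 6 → 1, orthogonality gives ‖Px‖² =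
‖P₁x‖² + ‖P₂x‖² = ⟪x, Px⟫, and Cauchy–Schwarz gives ⟪y, s⟫ ≤ ‖Py‖ ‖s‖ for s in the range of P. That
range is dense in K₁ + K₂ (`exists_norm_sub_projector_add_projector_lt`), so the bound holds on all
of K₁ + K₂. Completing the square then makes Py the nearest point of K₁ + K₂, and a set with nearest
points everywhere is closed. The distance formulas follow from d_K² = ‖x‖² - ‖P_K x‖² and Moreau's
decomposition. -/

theorem IsClosedConvexCone.add_mem {H : Type*} [NormedAddCommGroup H] [InnerProductSpace ℝ H]
    {K : Set H} (hK : IsClosedConvexCone K) {x y : H} (hx : x ∈ K) (hy : y ∈ K) : x + y ∈ K := by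
  have h := hK.convex (hK.smul_mem 2 two_pos x hx) (hK.smul_mem 2 two_pos y hy)
    (by norm_num : (0 : ℝ) ≤ 1 / 2) (by norm_num : (0 : ℝ) ≤ 1 / 2) (by norm_num)
  simpa [smul_smul] using h

theorem isNearestPoint_of_forall_norm_sub_le {H : Type*} [NormedAddCommGroup H] {C : Set H}
    {x p : H} (hp : p ∈ C) (h : ∀ c ∈ C, ‖x - p‖ ≤ ‖x - c‖) : IsNearestPoint C x p := by
  refine ⟨hp, le_antisymm ?_ (Metric.infDist_le_dist_of_mem hp)⟩
  rw [Metric.le_infDist ⟨p, hp⟩]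
  intro c hc
  simpa only [dist_eq_norm] using h c hc

/-! ### Projections onto closed convex cones -/

section Projector

variable {H : Type*} [NormedAddCommGroup H] [InnerProductSpace ℝ H] [CompleteSpace H] {K : Set H}

theorem IsClosedConvexCone.isNearestPoint_projector (hK : IsClosedConvexCone K) (x : H) :
    IsNearestPoint K x (projector K x) :=
  (projector_eq_iff hK.nonempty hK.isClosed hK.convex x _).1 rfl

theorem IsClosedConvexCone.projector_mem (hK : IsClosedConvexCone K) (x : H) :
    projector K x ∈ K :=
  (hK.isNearestPoint_projector x).1

theorem IsClosedConvexCone.projector_of_mem (hK : IsClosedConvexCone K) {x : H} (hx : x ∈ K) :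
    projector K x = x :=
  (projector_eq_iff hK.nonempty hK.isClosed hK.convex x x).2
    ⟨hx, by rw [dist_self, Metric.infDist_zero_of_mem hx]⟩

theorem IsClosedConvexCone.inner_sub_projector_sub_le (hK : IsClosedConvexCone K) (x : H)
    {c : H} (hc : c ∈ K) : inner ℝ (x - projector K x) (c - projector K x) ≤ 0 := by
  have h := hK.isNearestPoint_projector x
  refine (norm_eq_iInf_iff_real_inner_le_zero hK.convex h.1).1 ?_ c hc
  have h2 := h.2
  rw [Metric.infDist_eq_iInf, dist_eq_norm] at h2
  simpa only [dist_eq_norm] using h2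

theorem IsClosedConvexCone.inner_sub_projector_le (hK : IsClosedConvexCone K) (x : H)
    {c : H} (hc : c ∈ K) : inner ℝ (x - projector K x) c ≤ 0 := by
  simpa using hK.inner_sub_projector_sub_le x (hK.add_mem hc (hK.projector_mem x))

theorem IsClosedConvexCone.inner_sub_projector_self (hK : IsClosedConvexCone K) (x : H) :
    inner ℝ (x - projector K x) (projector K x) = 0 := by
  have h₁ := hK.inner_sub_projector_le x (hK.projector_mem x)
  -- Shrinking P x by 1/2 stays in the cone and reverses the sign, in place of testing at 0.
  have h₂ := hK.inner_sub_projector_sub_le x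
    (hK.smul_mem (1 / 2) (by norm_num) _ (hK.projector_mem x))
  rw [inner_sub_right, inner_smul_right] at h₂
  linarith

theorem IsClosedConvexCone.inner_projector_self (hK : IsClosedConvexCone K) (x : H) :
    inner ℝ x (projector K x) = ‖projector K x‖ ^ 2 := by
  have h := hK.inner_sub_projector_self x
  rw [inner_sub_left, real_inner_self_eq_norm_sq] at h
  linarith

theorem IsClosedConvexCone.inner_le_inner_projector (hK : IsClosedConvexCone K) (x : H)
    {c : H} (hc : c ∈ K) : inner ℝ x c ≤ inner ℝ (projector K x) c := by
  have h := hK.inner_sub_projector_le x hc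
  rw [inner_sub_left] at h
  linarith

theorem IsClosedConvexCone.infDist_sq (hK : IsClosedConvexCone K) (x : H) :
    Metric.infDist x K ^ 2 = ‖x‖ ^ 2 - ‖projector K x‖ ^ 2 := by
  rw [← (hK.isNearestPoint_projector x).2, dist_eq_norm, norm_sub_sq_real,
    hK.inner_projector_self]
  ring

theorem IsClosedConvexCone.norm_projector_sub_sq_le (hK : IsClosedConvexCone K) (x y : H) :
    ‖projector K x - projector K y‖ ^ 2 ≤ inner ℝ (x - y) (projector K x - projector K y) := by
  have h₁ := hK.inner_sub_projector_sub_le x (hK.projector_mem y)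
  have h₂ := hK.inner_sub_projector_sub_le y (hK.projector_mem x)
  rw [← real_inner_self_eq_norm_sq]
  simp only [inner_sub_left, inner_sub_right] at h₁ h₂ ⊢
  linarith [real_inner_comm (projector K x) (projector K y)]

theorem IsClosedConvexCone.norm_projector_sub_le (hK : IsClosedConvexCone K) (x y : H) :
    ‖projector K x - projector K y‖ ≤ ‖x - y‖ := by
  have h₁ := hK.norm_projector_sub_sq_le x y
  have h₂ := real_inner_le_norm (x - y) (projector K x - projector K y)
  nlinarith [norm_nonneg (x - y), norm_nonneg (projector K x - projector K y)]

/-- Moreau's decomposition: x - P x is the projection onto the polar cone. For w polar, ⟪P x, x - w⟫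
≥ ‖P x‖², so Cauchy–Schwarz gives ‖x - w‖ ≥ ‖P x‖. -/
theorem IsClosedConvexCone.infDist_polarCone (hK : IsClosedConvexCone K) (x : H) :
    Metric.infDist x (polarCone K) = ‖projector K x‖ := by
  have h : IsNearestPoint (polarCone K) x (x - projector K x) := by
    refine isNearestPoint_of_forall_norm_sub_le ?_ ?_
    · intro c hc
      rw [real_inner_comm]
      exact hK.inner_sub_projector_le x hc
    · intro w hw
      rw [sub_sub_cancel]
      have h₁ := hw _ (hK.projector_mem x)
      have h₂ := real_inner_le_norm (projector K x) (x - w)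
      rw [inner_sub_right, real_inner_comm, hK.inner_projector_self] at h₂
      by_contra! h₃
      nlinarith [norm_nonneg (x - w)]
  rw [← h.2, dist_eq_norm, sub_sub_cancel]

end Projector

/-! ### Monotone, nonexpansive and proximity operators -/

section Operators

variable {H : Type*} [NormedAddCommGroup H] [InnerProductSpace ℝ H]

theorem IsNonexpansive.isMonotoneOperator_sub {T : H → H} (hT : IsNonexpansive T) :
    IsMonotoneOperator fun x => x - T x := by
  intro x y
  have h₁ := hT x y
  have h₂ := real_inner_le_norm (x - y) (T x - T y)
  rw [sub_sub_sub_comm, inner_sub_right, real_inner_self_eq_norm_sq]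
  nlinarith [norm_nonneg (x - y)]

/-- The resolvent equation of a monotone Lipschitz operator has a solution. -/
theorem IsMonotoneOperator.exists_add_smul_eq [CompleteSpace H] {T : H → H}
    (hT : IsMonotoneOperator T) {L : ℝ} (hL : ∀ x y, ‖T x - T y‖ ≤ L * ‖x - y‖) {δ : ℝ}
    (hδ : 0 < δ) (z : H) : ∃ x, T x + δ • x = z := by
  wlog hL0 : 0 ≤ L generalizing L
  · exact this (L := 0) (fun x y => (hL x y).trans
      (mul_le_mul_of_nonneg_right (le_of_not_ge hL0) (norm_nonneg _))) le_rfl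
  set M : ℝ := L + δ with hM
  have hM0 : 0 < M := by positivity
  -- This step size minimizes 1 - 2ηδ + η²M², the bound on the squared Lipschitz constant of `G`,
  -- with value 1 - ηδ < 1.
  set η : ℝ := δ / M ^ 2 with hη
  have hη0 : 0 < η := by positivity
  have hηM : η * M ^ 2 = δ := by rw [hη]; field_simp
  have hδM : η * δ ≤ 1 := by
    rw [hη, div_mul_eq_mul_div, div_le_one (by positivity)]
    nlinarith
  let G : H → H := fun x => x - η • (T x + δ • x - z)
  have hG : ∀ x y, ‖G x - G y‖ ≤ √(1 - η * δ) * ‖x - y‖ := by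
    intro x y
    set A : H := T x - T y + δ • (x - y) with hA
    have e : G x - G y = (x - y) - η • A := by
      simp only [G, hA]
      module
    have h₁ : ‖A‖ ≤ M * ‖x - y‖ := by
      refine (norm_add_le _ _).trans ?_
      rw [norm_smul, Real.norm_of_nonneg hδ.le, hM, add_mul]
      exact add_le_add_left (hL x y) _
    have h₂ : δ * ‖x - y‖ ^ 2 ≤ inner ℝ (x - y) A := by
      rw [hA, inner_add_right, inner_smul_right, real_inner_self_eq_norm_sq]
      linarith [hT x y]
    have h₃ : ‖A‖ ^ 2 ≤ M ^ 2 * ‖x - y‖ ^ 2 := by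
      rw [← mul_pow]
      exact pow_le_pow_left₀ (norm_nonneg _) h₁ 2
    refine le_of_sq_le_sq ?_ (by positivity)
    rw [mul_pow, Real.sq_sqrt (by linarith), e, norm_sub_sq_real, inner_smul_right, norm_smul,
      Real.norm_of_nonneg hη0.le, mul_pow]
    have h₄ : η ^ 2 * ‖A‖ ^ 2 ≤ η * δ * ‖x - y‖ ^ 2 := by
      calc η ^ 2 * ‖A‖ ^ 2 ≤ η ^ 2 * (M ^ 2 * ‖x - y‖ ^ 2) := by gcongr
        _ = η * (η * M ^ 2) * ‖x - y‖ ^ 2 := by ring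
        _ = η * δ * ‖x - y‖ ^ 2 := by rw [hηM]
    nlinarith [mul_le_mul_of_nonneg_left h₂ hη0.le]
  have hc : ContractingWith (√(1 - η * δ)).toNNReal G := by
    refine ⟨?_, LipschitzWith.of_dist_le_mul fun x y => ?_⟩
    · rw [Real.toNNReal_lt_one, Real.sqrt_lt' one_pos]
      nlinarith [mul_pos hη0 hδ]
    · rw [Real.coe_toNNReal _ (Real.sqrt_nonneg _), dist_eq_norm, dist_eq_norm]
      exact hG x y
  refine ⟨hc.fixedPoint, ?_⟩
  have hfix : G hc.fixedPoint = hc.fixedPoint := hc.fixedPoint_isFixedPt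
  have h := sub_eq_self.1 hfix
  exact sub_eq_zero.1 ((smul_eq_zero.1 h).resolve_left hη0.ne')

/-- Divide by t and let t → 0; this extracts the first-order condition from minimality along a
segment. -/
theorem le_of_forall_mul_le_of_sq {a b c : ℝ}
    (h : ∀ t : ℝ, 0 < t → t < 1 → t * a ≤ t * b + t ^ 2 * c) : a ≤ b := by
  by_contra! hab
  set t : ℝ := min (1 / 2) ((a - b) / (2 * (|c| + 1))) with ht
  have hc : 0 < |c| + 1 := by positivity
  have ht0 : 0 < t := lt_min (by norm_num) (div_pos (by linarith) (by positivity))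
  have ht1 : t < 1 := (min_le_left _ _).trans_lt (by norm_num)
  have h₁ : t * (2 * (|c| + 1)) ≤ a - b :=
    (le_div_iff₀ (by positivity)).1 (min_le_right _ _)
  have h₂ : a ≤ b + t * c := le_of_mul_le_mul_left (by linarith [h t ht0 ht1]) ht0
  nlinarith [le_abs_self c, mul_le_mul_of_nonneg_left (le_abs_self c) ht0.le]

/-- The subgradient inequality x - T x ∈ ∂f(T x), obtained by comparing T x with points of the
segment towards y. -/
theorem IsProxOf.inner_sub_le {f : H → EReal} {T : H → H} (hf : IsGammaZero f)
    (hT : IsProxOf f T) (x : H) {y : H} {α β : ℝ} (hα : f (T x) = α) (hβ : f y = β) :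
    α + inner ℝ (x - T x) (y - T x) ≤ β := by
  rcases eq_or_ne y (T x) with rfl | hy
  · have : α = β := by exact_mod_cast hα.symm.trans hβ
    simp [this]
  have key := le_of_forall_mul_le_of_sq (a := α + inner ℝ (x - T x) (y - T x)) (b := β)
    (c := 1 / 2 * ‖y - T x‖ ^ 2) ?_
  · exact key
  intro t ht0 ht1
  have hle : f (T x + t • (y - T x)) ≤ (((1 - t) * α + t * β : ℝ) : EReal) := by
    have h := hf.convex_epigraph (x := (T x, α)) (y := (y, β)) hα.le hβ.le
      (sub_nonneg.2 ht1.le) ht0.le (sub_add_cancel 1 t)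
    have e : (1 - t) • T x + t • y = T x + t • (y - T x) := by module
    simpa [e] using h
  have hne : T x + t • (y - T x) ≠ T x := by
    simp [ht0.ne', sub_ne_zero.2 hy]
  have hlt := (hT x _ hne).trans_le (add_le_add_left hle _)
  rw [hα] at hlt
  have hlt' : α + halfSq (x - T x) <
      (1 - t) * α + t * β + halfSq (x - (T x + t • (y - T x))) := by
    exact_mod_cast hlt
  simp only [halfSq] at hlt'
  rw [← sub_sub, norm_sub_sq_real (x - T x), inner_smul_right, norm_smul, mul_pow,
    Real.norm_eq_abs, sq_abs] at hlt'
  linarith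

theorem IsProximityOperator.isNonexpansive {T : H → H} (hT : IsProximityOperator T) :
    IsNonexpansive T := by
  obtain ⟨f, hf, hp⟩ := hT
  intro x y
  rcases eq_or_ne (T x) (T y) with h | h
  · rw [h, sub_self, norm_zero]
    exact norm_nonneg _
  -- Strict minimality against any other point excludes the value ⊤, so a second value of T already
  -- makes f (T u) finite.
  have hfin : ∀ u v, T v ≠ T u → ∃ α : ℝ, f (T u) = α := by
    intro u v huv
    have htop : f (T u) ≠ ⊤ := by
      intro e
      have := hp u (T v) huv
      rw [e, EReal.top_add_coe] at this
      exact not_top_lt this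
    exact ⟨(f (T u)).toReal, (EReal.coe_toReal htop (hf.ne_bot _)).symm⟩
  obtain ⟨α, hα⟩ := hfin x y h.symm
  obtain ⟨β, hβ⟩ := hfin y x h
  have h₁ := hp.inner_sub_le hf x hα hβ
  have h₂ := hp.inner_sub_le hf y hβ hα
  have h₃ : ‖T x - T y‖ ^ 2 ≤ inner ℝ (x - y) (T x - T y) := by
    rw [← real_inner_self_eq_norm_sq]
    simp only [inner_sub_left, inner_sub_right] at h₁ h₂ ⊢
    linarith [real_inner_comm (T x) (T y)]
  have h₄ := real_inner_le_norm (x - y) (T x - T y)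
  nlinarith [norm_nonneg (x - y), norm_nonneg (T x - T y)]

open Classical in
theorem IsClosedConvexCone.isProximityOperator_projector [CompleteSpace H] {K : Set H}
    (hK : IsClosedConvexCone K) : IsProximityOperator (projector K) := by
  -- The indicator function of K; its epigraph is K × [0, ∞).
  let f : H → EReal := fun x => if x ∈ K then 0 else ⊤
  have hmem : ∀ {x}, x ∈ K → f x = 0 := fun h => if_pos h
  have hnot : ∀ {x}, x ∉ K → f x = ⊤ := fun h => if_neg h
  refine ⟨f, ⟨?_, ?_, ?_, ?_⟩, ?_⟩
  · intro x
    by_cases hx : x ∈ K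
    · simp [hmem hx]
    · simp [hnot hx]
  · obtain ⟨x, hx⟩ := hK.nonempty
    exact ⟨x, by simp [hmem hx]⟩
  · intro x a ha
    by_cases hx : x ∈ K
    · rw [hmem hx] at ha
      refine Filter.Eventually.of_forall fun y => ha.trans_le ?_
      by_cases hy : y ∈ K
      · simp [hmem hy]
      · simp [hnot hy]
    · rw [hnot hx] at ha
      filter_upwards [hK.isClosed.isOpen_compl.mem_nhds hx] with y hy
      rwa [hnot hy]
  · have e : {p : H × ℝ | f p.1 ≤ (p.2 : EReal)} = K ×ˢ Set.Ici 0 := by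
      ext ⟨x, r⟩
      by_cases hx : x ∈ K
      · simp [hmem hx, hx]
      · simp [hnot hx, hx]
    rw [e]
    exact hK.convex.prod (convex_Ici 0)
  · intro x y hy
    rw [hmem (hK.projector_mem x), zero_add]
    by_cases hyK : y ∈ K
    · rw [hmem hyK, zero_add, EReal.coe_lt_coe_iff]
      have hp := hK.isNearestPoint_projector x
      have hlt : ‖x - projector K x‖ < ‖x - y‖ := by
        refine lt_of_le_of_ne ?_ fun e => hy ?_
        · rw [← dist_eq_norm, ← dist_eq_norm, hp.2]
          exact Metric.infDist_le_dist_of_mem hyK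
        · refine ((projector_eq_iff hK.nonempty hK.isClosed hK.convex x y).2 ⟨hyK, ?_⟩).symm
          rw [dist_eq_norm, ← e, ← dist_eq_norm, hp.2]
      simp only [halfSq]
      gcongr
    · rw [hnot hyK, EReal.top_add_coe]
      exact EReal.coe_lt_top _

end Operators

/-! ### The sum of two projectors -/

section SumOfProjectors

variable {H : Type*} [NormedAddCommGroup H] [InnerProductSpace ℝ H] {K₁ K₂ : Set H}

theorem IsClosedConvexCone.add (hK₁ : IsClosedConvexCone K₁) (hK₂ : IsClosedConvexCone K₂)
    (h : IsClosed (K₁ + K₂)) : IsClosedConvexCone (K₁ + K₂) where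
  nonempty := hK₁.nonempty.add hK₂.nonempty
  isClosed := h
  convex := hK₁.convex.add hK₂.convex
  smul_mem := by
    rintro c hc _ ⟨a, ha, b, hb, rfl⟩
    exact ⟨c • a, hK₁.smul_mem c hc a ha, c • b, hK₂.smul_mem c hc b hb, (smul_add c a b).symm⟩

theorem norm_projector_add_projector_sq
    (h : ∀ x, inner ℝ (projector K₁ x) (projector K₂ x) = 0) (x : H) :
    ‖projector K₁ x + projector K₂ x‖ ^ 2 = ‖projector K₁ x‖ ^ 2 + ‖projector K₂ x‖ ^ 2 := by
  rw [norm_add_sq_real, h x]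
  ring

variable [CompleteSpace H]

theorem inner_projector_eq_zero_of_isMonotoneOperator (hK₁ : IsClosedConvexCone K₁)
    (hK₂ : IsClosedConvexCone K₂)
    (h : IsMonotoneOperator fun x => x - projector K₁ x - projector K₂ x) (x : H) :
    inner ℝ (projector K₁ x) (projector K₂ x) = 0 := by
  have hz : ∀ {K : Set H}, IsClosedConvexCone K → projector K 0 = 0 := by
    intro K hK
    have := hK.inner_projector_self 0
    rw [inner_zero_left] at this
    exact norm_eq_zero.1 (pow_eq_zero_iff two_ne_zero |>.1 this.symm)
  -- Between c and 0, monotonicity reads -‖P₂c‖² ≥ 0.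
  have hvanish : ∀ c ∈ K₁, projector K₂ c = 0 := by
    intro c hc
    have h₀ := h c 0
    simp only [hz hK₁, hz hK₂, hK₁.projector_of_mem hc, sub_zero, sub_self, zero_sub,
      inner_neg_right, hK₂.inner_projector_self] at h₀
    exact norm_eq_zero.1 (pow_eq_zero_iff two_ne_zero |>.1 (by nlinarith))
  set p := projector K₁ x with hp
  have hpK : p ∈ K₁ := hK₁.projector_mem x
  refine le_antisymm ?_ ?_
  · have := hK₂.inner_sub_projector_le p (hK₂.projector_mem x)
    rwa [hvanish p hpK, sub_zero] at this
  · by_contra! hneg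
    -- Monotonicity between x and t p, where Id - P₁ - P₂ vanishes at t p and ⟪p, x - p⟫ = 0.
    have hb : ∀ t : ℝ, 0 < t → 0 ≤ inner ℝ x (x - p - projector K₂ x) +
        t * inner ℝ p (projector K₂ x) := by
      intro t ht
      have hm := hK₁.smul_mem t ht p hpK
      have h₁ := h x (t • p)
      have h₂ := hK₁.inner_sub_projector_self x
      rw [← hp, real_inner_comm] at h₂
      simp only [hvanish _ hm, hK₁.projector_of_mem hm, ← hp, sub_self, sub_zero,
        inner_sub_left, real_inner_smul_left] at h₁
      rw [inner_sub_right p, h₂] at h₁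
      linarith
    -- With A the constant term and B < 0 the slope, t = |A|/(-B) + 1 gives A + tB = A - |A| + B <
    -- 0.
    have h₁ := hb (|inner ℝ x (x - p - projector K₂ x)| / (-inner ℝ p (projector K₂ x)) + 1)
      (by have := neg_pos.2 hneg; positivity)
    have h₂ : |inner ℝ x (x - p - projector K₂ x)| / (-inner ℝ p (projector K₂ x)) *
        inner ℝ p (projector K₂ x) = -|inner ℝ x (x - p - projector K₂ x)| := by
      have := hneg.ne
      field_simp
    rw [add_mul, h₂] at h₁
    linarith [le_abs_self (inner ℝ x (x - p - projector K₂ x))]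

/-- The range of `P₁ + P₂` is dense in `K₁ + K₂`. -/
theorem exists_norm_sub_projector_add_projector_lt (hK₁ : IsClosedConvexCone K₁)
    (hK₂ : IsClosedConvexCone K₂) {a b : H} (ha : a ∈ K₁) (hb : b ∈ K₂) {ε : ℝ} (hε : 0 < ε) :
    ∃ x, ‖a + b - (projector K₁ x + projector K₂ x)‖ < ε := by
  -- With P x + δx = a + b, the error is δx, and pairing with x gives δ‖x‖² ≤ ‖a‖² + ‖b‖². Hence
  -- ‖δx‖² < δR = ε²; the extra 1 makes R positive and the bound strict.
  set R : ℝ := ‖a‖ ^ 2 + ‖b‖ ^ 2 + 1 with hR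
  have hR0 : 0 < R := by positivity
  have hmono : IsMonotoneOperator fun x => projector K₁ x + projector K₂ x := by
    intro x y
    rw [add_sub_add_comm, inner_add_right]
    nlinarith [hK₁.norm_projector_sub_sq_le x y, hK₂.norm_projector_sub_sq_le x y,
      sq_nonneg ‖projector K₁ x - projector K₁ y‖, sq_nonneg ‖projector K₂ x - projector K₂ y‖]
  obtain ⟨x, hx⟩ := hmono.exists_add_smul_eq (L := 2) (fun x y => by
    rw [add_sub_add_comm]
    refine (norm_add_le _ _).trans ?_
    linarith [hK₁.norm_projector_sub_le x y, hK₂.norm_projector_sub_le x y])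
    (δ := ε ^ 2 / R) (by positivity) (a + b)
  refine ⟨x, ?_⟩
  set δ : ℝ := ε ^ 2 / R with hδ
  have hδ0 : 0 < δ := by positivity
  have hδR : δ * R = ε ^ 2 := by rw [hδ]; field_simp
  have e : a + b - (projector K₁ x + projector K₂ x) = δ • x := by
    rw [← hx]; abel
  have h₁ : δ * ‖x‖ ^ 2 ≤ ‖a‖ ^ 2 + ‖b‖ ^ 2 := by
    have h₂ : inner ℝ x (a + b - (projector K₁ x + projector K₂ x)) = δ * ‖x‖ ^ 2 := by
      rw [e, inner_smul_right, real_inner_self_eq_norm_sq]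
    rw [inner_sub_right, inner_add_right, inner_add_right, hK₁.inner_projector_self,
      hK₂.inner_projector_self] at h₂
    have h₃ := (hK₁.inner_le_inner_projector x ha).trans (real_inner_le_norm _ _)
    have h₄ := (hK₂.inner_le_inner_projector x hb).trans (real_inner_le_norm _ _)
    nlinarith [sq_nonneg (‖projector K₁ x‖ - ‖a‖), sq_nonneg (‖projector K₂ x‖ - ‖b‖),
      sq_nonneg ‖projector K₁ x‖, sq_nonneg ‖projector K₂ x‖, sq_nonneg ‖a‖, sq_nonneg ‖b‖]
  rw [e, norm_smul, Real.norm_of_nonneg hδ0.le]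
  refine lt_of_pow_lt_pow_left₀ 2 hε.le ?_
  rw [← hδR]
  nlinarith

theorem inner_projector_add_projector (hK₁ : IsClosedConvexCone K₁)
    (hK₂ : IsClosedConvexCone K₂) (h : ∀ x, inner ℝ (projector K₁ x) (projector K₂ x) = 0)
    (x : H) : inner ℝ x (projector K₁ x + projector K₂ x) =
      ‖projector K₁ x + projector K₂ x‖ ^ 2 := by
  rw [norm_projector_add_projector_sq h, inner_add_right, hK₁.inner_projector_self,
    hK₂.inner_projector_self]

theorem inner_le_norm_projector_add_projector_mul (hK₁ : IsClosedConvexCone K₁)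
    (hK₂ : IsClosedConvexCone K₂) (h : ∀ x, inner ℝ (projector K₁ x) (projector K₂ x) = 0)
    (y : H) {s : H} (hs : s ∈ K₁ + K₂) :
    inner ℝ y s ≤ ‖projector K₁ y + projector K₂ y‖ * ‖s‖ := by
  have hrange : ∀ x, inner ℝ y (projector K₁ x + projector K₂ x) ≤
      ‖projector K₁ y + projector K₂ y‖ * ‖projector K₁ x + projector K₂ x‖ := by
    intro x
    have h₁ := (hK₁.inner_le_inner_projector y (hK₁.projector_mem x)).trans
      (real_inner_le_norm _ _)
    have h₂ := (hK₂.inner_le_inner_projector y (hK₂.projector_mem x)).trans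
      (real_inner_le_norm _ _)
    rw [inner_add_right]
    -- Cauchy–Schwarz in ℝ² for the vectors (‖P₁y‖, ‖P₂y‖) and (‖P₁x‖, ‖P₂x‖).
    refine (add_le_add h₁ h₂).trans (abs_le_of_sq_le_sq' ?_ (by positivity)).2
    rw [mul_pow, norm_projector_add_projector_sq h, norm_projector_add_projector_sq h]
    nlinarith [sq_nonneg (‖projector K₁ y‖ * ‖projector K₂ x‖ -
      ‖projector K₂ y‖ * ‖projector K₁ x‖)]
  have hclosed : IsClosed {s : H | inner ℝ y s ≤ ‖projector K₁ y + projector K₂ y‖ * ‖s‖} :=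
    isClosed_le (by fun_prop) (by fun_prop)
  obtain ⟨a, ha, b, hb, rfl⟩ := hs
  refine hclosed.closure_subset_iff.2 (Set.range_subset_iff.2 hrange) (Metric.mem_closure_iff.2 fun ε hε => ?_)
  obtain ⟨x, hx⟩ := exists_norm_sub_projector_add_projector_lt hK₁ hK₂ ha hb hε
  exact ⟨_, ⟨x, rfl⟩, by rwa [dist_eq_norm]⟩

/-- ‖x - s‖² ≥ ‖x‖² - 2‖Px‖ ‖s‖ + ‖s‖² ≥ ‖x‖² - ‖Px‖² = ‖x - Px‖². -/
theorem isNearestPoint_projector_add_projector (hK₁ : IsClosedConvexCone K₁)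
    (hK₂ : IsClosedConvexCone K₂) (h : ∀ x, inner ℝ (projector K₁ x) (projector K₂ x) = 0)
    (x : H) : IsNearestPoint (K₁ + K₂) x (projector K₁ x + projector K₂ x) := by
  refine isNearestPoint_of_forall_norm_sub_le
    (Set.add_mem_add (hK₁.projector_mem x) (hK₂.projector_mem x)) fun s hs => ?_
  have h₁ := inner_le_norm_projector_add_projector_mul hK₁ hK₂ h x hs
  refine le_of_sq_le_sq ?_ (norm_nonneg _)
  rw [norm_sub_sq_real, norm_sub_sq_real, inner_projector_add_projector hK₁ hK₂ h]
  nlinarith [sq_nonneg (‖projector K₁ x + projector K₂ x‖ - ‖s‖)]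

/-- A point of the closure is at distance 0 from its nearest point in K₁ + K₂, hence equals it. -/
theorem isClosed_add_of_inner_projector_eq_zero (hK₁ : IsClosedConvexCone K₁)
    (hK₂ : IsClosedConvexCone K₂) (h : ∀ x, inner ℝ (projector K₁ x) (projector K₂ x) = 0) :
    IsClosed (K₁ + K₂) := by
  refine isClosed_of_closure_subset fun s hs => ?_
  obtain ⟨h₁, h₂⟩ := isNearestPoint_projector_add_projector hK₁ hK₂ h s
  rw [← Metric.infDist_closure, Metric.infDist_zero_of_mem hs] at h₂
  rwa [dist_eq_zero.1 h₂]

end SumOfProjectors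

theorem theoremt {H : Type*} [NormedAddCommGroup H] [InnerProductSpace ℝ H] [CompleteSpace H]
    (K₁ K₂ : Set H) (hK₁ : IsClosedConvexCone K₁) (hK₂ : IsClosedConvexCone K₂) :
    List.TFAE [
      IsClosed (K₁ + K₂) ∧ ∀ x, projector K₁ x + projector K₂ x = projector (K₁ + K₂) x,
      ∃ K : Set H, IsClosedConvexCone K ∧ ∀ x, projector K₁ x + projector K₂ x = projector K x,
      IsProximityOperator (fun x => projector K₁ x + projector K₂ x),
      IsNonexpansive (fun x => projector K₁ x + projector K₂ x),
      IsMonotoneOperator (fun x => x - projector K₁ x - projector K₂ x),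
      ∀ x, inner ℝ (projector K₁ x) (projector K₂ x) = 0] ∧
    ((∀ x, inner ℝ (projector K₁ x) (projector K₂ x) = 0) →
      ∀ x,
        Metric.infDist x (K₁ + K₂) ^ 2
            = Metric.infDist x K₁ ^ 2 + Metric.infDist x K₂ ^ 2 - 2 * halfSq x ∧
        Metric.infDist x K₁ ^ 2 + Metric.infDist x K₂ ^ 2 - 2 * halfSq x
            = Metric.infDist x K₁ ^ 2 - Metric.infDist x (polarCone K₂) ^ 2 ∧
        Metric.infDist x K₁ ^ 2 - Metric.infDist x (polarCone K₂) ^ 2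
            = Metric.infDist x K₂ ^ 2 - Metric.infDist x (polarCone K₁) ^ 2) := by
  refine ⟨?_, fun h x => ?_⟩
  · tfae_have 1 → 2 := fun h => ⟨K₁ + K₂, hK₁.add hK₂ h.1, h.2⟩
    tfae_have 2 → 3 := by
      rintro ⟨K, hK, h⟩
      rw [funext h]
      exact hK.isProximityOperator_projector
    tfae_have 3 → 4 := IsProximityOperator.isNonexpansive
    tfae_have 4 → 5 := by
      intro h
      simpa only [sub_sub] using h.isMonotoneOperator_sub
    tfae_have 5 → 6 := inner_projector_eq_zero_of_isMonotoneOperator hK₁ hK₂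
    tfae_have 6 → 1 := by
      intro h
      have hc := isClosed_add_of_inner_projector_eq_zero hK₁ hK₂ h
      have hK := hK₁.add hK₂ hc
      exact ⟨hc, fun x => ((projector_eq_iff hK.nonempty hc hK.convex x _).2
        (isNearestPoint_projector_add_projector hK₁ hK₂ h x)).symm⟩
    tfae_finish
  · rw [← (isNearestPoint_projector_add_projector hK₁ hK₂ h x).2, dist_eq_norm,
      norm_sub_sq_real, inner_projector_add_projector hK₁ hK₂ h,
      norm_projector_add_projector_sq h, hK₁.infDist_sq, hK₂.infDist_sq, hK₁.infDist_polarCone,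
      hK₂.infDist_polarCone, halfSq]
    refine ⟨?_, ?_, ?_⟩ <;> ring
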